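/- **Setting.** Let $(\Omega,(\mathcal F_t)_{t\in\mathbb N})$, $\mathbb N=\{1,2,\dots\}$, be a filtered measurable space, $\mathcal P$ a set of probability distributions on it, $H_1,H_2,\dots\subseteq\mathcal P$ hypotheses, and $\alpha\in(0,1]$. For $\mathbb P\in\mathcal P$ let $I_0^{\mathbb P}=\{t:\mathbb P\in H_t\}$ and $I_1^{\mathbb P}=\mathbb N\setminus I_0^{\mathbb P}$; let $H_I=\bigcap_{i\in I}H_i$ ($H_\emptyset=\mathcal P$). Let $E_1,E_2,\dots$ be e-values for $H_1,H_2,\dots$: $E_t$ is $[0,\infty]$-valued, $\mathcal F_t$-measurable and $\mathbb E_{\mathbb P}[E_t]\le 1$ for all $\mathbb P\in H_t$. Suppose that for every $\mathbb P\in\mathcal P$ the null e-values $(E_t)_{t\in I_0^{\mathbb P}}$ are exchangeable under $\mathbb P$ (their joint law is invariant under permutations of finitely many indices). For $I\subseteq\mathbb N$ define $$\phi_I=\mathbf 1\Big\{\exists t\in I:\ \frac{1}{|\{i\in I:i\le t\}|}\sum_{i\in I,\,i\le t}E_i\ \ge\ 1/\alpha\Big\},$$ and for finite $S\subseteq\mathbb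 N$ let $d^{\phi}(S)=\inf\{|S\setminus I|: I\subseteq\mathbb N,\ \phi_I=0\}$ be the corresponding closed procedure. **ExE-Guard.** Start with $S_0=A=U=\emptyset$, $d_0=0$. For $t=1,2,\dots$: decide (in any way) whether $t$ is included in the query set. - If yes, put $S_t=S_{t-1}\cup\{t\}$ and add $t$ to $A$; if then the average of $E_i$ over $i\in A\cup U$ is at least $1/\alpha$, set $d_t=d_{t-1}+1$ and remove from $A$ the index of a largest e-value in $A$ (ties broken arbitrarily); otherwise set $d_t=d_{t-1}$. - If no, put $S_t=S_{t-1}$, $d_t=d_{t-1}$, and add $t$ to $U$ if $E_t<1/\alpha$. **Theorem.** 1. $(\phi_I)_{I\subseteq\mathbb N}$ is an increasing family of online intersection tests of level $\alpha$: $\mathbb P(\phi_I=1)\le\alpha$ for all $\mathbb P\in H_I$; $\phi_I$ is $\mathcal F_{\sup I}$-measurable (with $\mathcal F_\infty=\sigma(\bigcup_t\mathcal F_t)$, and the trivial $\sigma$-algebra if $I=\emptyset$); and $\phi_I\le\phi_{I\cup K}$ whenever $I\subseteq\{1,\dots,i\}$ and $K\subseteq\{i+1,i+2,\dots\}$. 2.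 Hence $d^{\phi}$ is an online closed procedure: $d^{\phi}(S)$ is $\mathcal F_{\max S}$-measurable for every finite $S$, and $\mathbb P\big(d^{\phi}(S)\le|S\cap I_1^{\mathbb P}|\text{ for all finite }S\subseteq\mathbb N\big)\ge1-\alpha$ for all $\mathbb P\in\mathcal P$. 3. For every choice of the query sets and every tie-breaking, the bounds of ExE-Guard coincide with those of the online closed procedure: $d_t=d^{\phi}(S_t)$ for all $t$ and all $\omega\in\Omega$. In particular, for all $\mathbb P\in\mathcal P$, $$\mathbb P\big(d_t\le|S_t\cap I_1^{\mathbb P}|\text{ for all }t\in\mathbb N\big)\ge1-\alpha .$$ -/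

import Mathlib

open MeasureTheory
open scoped ENNReal

namespace OnlineDiscovery

/-! Hypotheses, e-values and the information `ℱ t` available when hypothesis `t` is tested are
indexed by `t = 0, 1, 2, …`; this is `1, 2, 3, …` shifted by one. -/

section Testing

variable {Ω : Type*} {m : MeasurableSpace Ω}

/-- The index set of the true null hypotheses under `P`. -/
def trueNulls (H : ℕ → Set (ProbabilityMeasure Ω)) (P : ProbabilityMeasure Ω) : Set ℕ :=
  {t | P ∈ H t}

/-- The index set of the false null hypotheses under `P`. -/
def falseNulls (H : ℕ → Set (ProbabilityMeasure Ω)) (P : ProbabilityMeasure Ω) : Set ℕ :=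
  {t | P ∉ H t}

/-- The intersection hypothesis `H_I` inside the model `𝓜` (so `H_∅ = 𝓜`). -/
def interHyp (𝓜 : Set (ProbabilityMeasure Ω)) (H : ℕ → Set (ProbabilityMeasure Ω))
    (I : Set ℕ) : Set (ProbabilityMeasure Ω) :=
  {P | P ∈ 𝓜 ∧ ∀ i ∈ I, P ∈ H i}

/-- A family of random variables is exchangeable if its joint law is invariant under every
permutation of finitely many indices. -/
def Exchangeable {ι β : Type*} [MeasurableSpace β] (X : ι → Ω → β) (P : Measure Ω) : Prop :=
  ∀ σ : Equiv.Perm ι, {i | σ i ≠ i}.Finite →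
    P.map (fun ω i => X (σ i) ω) = P.map (fun ω i => X i ω)

/-- `φ I ω` means that the test of `H_I` rejects on `ω` (`φ_I(ω) = 1`). The family consists of
level `α` tests. -/
def IsLevelTests (𝓜 : Set (ProbabilityMeasure Ω)) (H : ℕ → Set (ProbabilityMeasure Ω)) (α : ℝ)
    (φ : Set ℕ → Ω → Prop) : Prop :=
  ∀ I : Set ℕ, ∀ P ∈ interHyp 𝓜 H I, (P : Measure Ω) {ω | φ I ω} ≤ ENNReal.ofReal α

/-- Every `φ_I` is measurable with respect to `ℱ_{sup I}`; here `ℱ_{sup I}` is the `σ`-algebra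
generated by the `ℱ i`, `i ∈ I` (`ℱ (max I)` for finite nonempty `I`, the trivial one for
`I = ∅`, and `ℱ_∞` for infinite `I`). -/
def IsOnlineTests (ℱ : Filtration ℕ m) (φ : Set ℕ → Ω → Prop) : Prop :=
  ∀ I : Set ℕ, MeasurableSet[⨆ i ∈ I, ℱ i] {ω | φ I ω}

/-- The family of tests is increasing: `φ_I ≤ φ_{I ∪ K}` if `K` lies entirely after `I`. -/
def IsIncreasing (φ : Set ℕ → Ω → Prop) : Prop :=
  ∀ (i : ℕ) (I K : Set ℕ), I ⊆ Set.Iic i → K ⊆ Set.Ioi i → ∀ ω, φ I ω → φ (I ∪ K) ω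

/-- The closed procedure `d^φ(S) = inf {|S \ I| : I ⊆ ℕ, φ_I = 0}`. -/
noncomputable def closedProcedure (φ : Set ℕ → Ω → Prop) (S : Finset ℕ) (ω : Ω) : ℕ :=
  sInf {n | ∃ I : Set ℕ, ¬ φ I ω ∧ n = ((S : Set ℕ) \ I).ncard}

/-- `d(S)` is measurable with respect to `ℱ_{max S}` for all finite `S`. -/
def IsOnlineProcedure (ℱ : Filtration ℕ m) (d : Finset ℕ → Ω → ℕ) : Prop :=
  ∀ S : Finset ℕ, Measurable[⨆ i ∈ S, ℱ i] (d S)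

/-- Simultaneous true discovery guarantee at level `α` over all finite sets. -/
def HasTrueDiscoveryGuarantee (𝓜 : Set (ProbabilityMeasure Ω))
    (H : ℕ → Set (ProbabilityMeasure Ω)) (α : ℝ) (d : Finset ℕ → Ω → ℕ) : Prop :=
  ∀ P ∈ 𝓜, ENNReal.ofReal (1 - α) ≤
    (P : Measure Ω) {ω | ∀ S : Finset ℕ, d S ω ≤ ((S : Set ℕ) ∩ falseNulls H P).ncard}

end Testing

/-- The average of `e` over a finite index set (used for nonempty sets only). -/
noncomputable def average (e : ℕ → ℝ≥0∞) (F : Finset ℕ) : ℝ≥0∞ :=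
  (∑ i ∈ F, e i) / (F.card : ℝ≥0∞)

open Classical in
/-- The finite set `{i ∈ I : i ≤ t}`. -/
noncomputable def upTo (I : Set ℕ) (t : ℕ) : Finset ℕ :=
  {i ∈ Finset.range (t + 1) | i ∈ I}

/-- The intersection test that rejects if at some `t ∈ I` the running average over `I` is at
least `1 / α`. -/
def exeTest {Ω : Type*} (α : ℝ) (E : ℕ → Ω → ℝ≥0∞) (I : Set ℕ) (ω : Ω) : Prop :=
  ∃ t ∈ I, 1 / ENNReal.ofReal α ≤ average (fun i => E i ω) (upTo I t)

/-- The empty set is never rejected, so the infimum in the closed procedure is over a nonempty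
set. -/
theorem not_exeTest_empty {Ω : Type*} (α : ℝ) (E : ℕ → Ω → ℝ≥0∞) (ω : Ω) :
    ¬ exeTest α E ∅ ω := by
  rintro ⟨t, ht, _⟩
  exact ht

/-- The variables of the algorithm: the query set `S`, the index set `A` of the queried and not
excluded e-values, the index set `U` of the small e-values outside the query set, and the true
discovery bound `d`. -/
structure GuardState where
  S : Finset ℕ
  A : Finset ℕ
  U : Finset ℕ
  d : ℕ

/-- One pass of the loop for index `t`. The choice of whether `t` is put into the query set is
free, and so is the choice among the largest e-values in `A` in case of ties. -/
inductive GuardStep (α : ℝ) (e : ℕ → ℝ≥0∞) (t : ℕ) (s : GuardState) : GuardState → Prop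
  /-- `t` is queried and the average reaches `1 / α`; `k` is the index of a largest e-value. -/
  | discover (k : ℕ) (havg : 1 / ENNReal.ofReal α ≤ average e (insert t s.A ∪ s.U))
      (hk : k ∈ insert t s.A) (hmax : ∀ j ∈ insert t s.A, e j ≤ e k) :
      GuardStep α e t s ⟨insert t s.S, (insert t s.A).erase k, s.U, s.d + 1⟩
  /-- `t` is queried and the average does not reach `1 / α`. -/
  | keep (havg : average e (insert t s.A ∪ s.U) < 1 / ENNReal.ofReal α) :
      GuardStep α e t s ⟨insert t s.S, insert t s.A, s.U, s.d⟩
  /-- `t` is not queried and its e-value is smaller than `1 / α`. -/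
  | small (he : e t < 1 / ENNReal.ofReal α) :
      GuardStep α e t s ⟨s.S, s.A, insert t s.U, s.d⟩
  /-- `t` is not queried and its e-value is at least `1 / α`. -/
  | large (he : 1 / ENNReal.ofReal α ≤ e t) :
      GuardStep α e t s ⟨s.S, s.A, s.U, s.d⟩

/-- A run of the algorithm on the e-values `e`: `s n` is the state after the first `n` passes of
the loop, that is, after the indices `0, …, n - 1`. -/
def IsGuardRun (α : ℝ) (e : ℕ → ℝ≥0∞) (s : ℕ → GuardState) : Prop :=
  s 0 = ⟨∅, ∅, ∅, 0⟩ ∧ ∀ t, GuardStep α e t (s t) (s (t + 1))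

end OnlineDiscovery

namespace OnlineDiscovery

open Finset

/-! Write `c` for `1 / α`. Level: split the rejection event up to a finite time `M` by the last time
`t` at which the running average over `I` reaches `c`. This event is invariant under swaps of
indices of `I` up to `t`, so by exchangeability all these e-values have the same integral over it.
Their sum there is at least `c` times their number, so each integral, in particular that of the
first e-value of `I`, is at least `c` times the probability of the event
(`Exchangeable.mul_measure_lastCrossing_le`). Summing over `t` bounds `c` times the rejection
probability by the mean of one e-value, which is at most `1`.

Equality of the bounds: `A ∪ U` is never rejected and leaves out exactly `d` queried indices, so the
closed procedure is at most `d`. Conversely, suppose an unrejected `I` first leaves out fewer than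
`d` queried indices after pass `n`. Then pass `n` is a discovery, `n ∈ I`, and `I` left out exactly
as many indices as the algorithm before. Excluding greedily leaves the smallest sum among all
exclusions that were never behind (`IsGuardRun.sum_le`), and `U` is the least favourable set of
unqueried indices relative to `c`. So the average over `I` at `n` reaches `c` because that over `A ∪
U ∪ {n}` does, a contradiction. -/

theorem threshold_ne_top {α : ℝ} (hα : 0 < α) : 1 / ENNReal.ofReal α ≠ ⊤ := by
  simp [hα]

theorem le_average_iff {c : ℝ≥0∞} {e : ℕ → ℝ≥0∞} {F : Finset ℕ} (hF : F.Nonempty) :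
    c ≤ average e F ↔ c * F.card ≤ ∑ i ∈ F, e i := by
  have h0 : (F.card : ℝ≥0∞) ≠ 0 := by simpa using hF.ne_empty
  exact ENNReal.le_div_iff_mul_le (Or.inl h0) (Or.inl (ENNReal.natCast_ne_top _))

theorem average_lt_iff {c : ℝ≥0∞} {e : ℕ → ℝ≥0∞} {F : Finset ℕ} (hF : F.Nonempty) :
    average e F < c ↔ ∑ i ∈ F, e i < c * F.card := by
  rw [← not_le, ← not_le, le_average_iff hF]

theorem mem_upTo {I : Set ℕ} {t i : ℕ} : i ∈ upTo I t ↔ i ≤ t ∧ i ∈ I := by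
  simp [upTo]

theorem upTo_nonempty {I : Set ℕ} {t : ℕ} (ht : t ∈ I) : (upTo I t).Nonempty :=
  ⟨t, mem_upTo.2 ⟨le_rfl, ht⟩⟩

/-- The structural relations between the variables of the algorithm after `n` passes. -/
structure GuardInvariant (c : ℝ≥0∞) (e : ℕ → ℝ≥0∞) (n : ℕ) (s : GuardState) : Prop where
  S_subset : s.S ⊆ range n
  A_subset : s.A ⊆ s.S
  U_eq : s.U = {i ∈ range n | i ∉ s.S ∧ e i < c}
  card_eq : (s.S \ s.A).card = s.d
  -- All truncations are needed, since the test looks at every running average. Sums are used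
  -- instead of averages, and the empty truncation is left out because `0 < 0` fails.
  sum_lt : ∀ m, {i ∈ s.A ∪ s.U | i ≤ m}.Nonempty →
    ∑ i ∈ s.A ∪ s.U with i ≤ m, e i < c * ({i ∈ s.A ∪ s.U | i ≤ m}.card : ℝ≥0∞)

/-! ### Preservation of the invariant by one pass -/

namespace GuardInvariant

variable {c : ℝ≥0∞} {e : ℕ → ℝ≥0∞} {n : ℕ} {s : GuardState}

theorem mem_U (h : GuardInvariant c e n s) {i : ℕ} :
    i ∈ s.U ↔ i < n ∧ i ∉ s.S ∧ e i < c := by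
  rw [h.U_eq]; simp

theorem lt_of_mem_S (h : GuardInvariant c e n s) {i : ℕ} (hi : i ∈ s.S) : i < n :=
  mem_range.1 (h.S_subset hi)

theorem lt_of_mem (h : GuardInvariant c e n s) {i : ℕ} (hi : i ∈ s.A ∪ s.U) : i < n := by
  rcases mem_union.1 hi with hi | hi
  · exact h.lt_of_mem_S (h.A_subset hi)
  · exact (h.mem_U.1 hi).1

/-- E-values may be infinite; finiteness of this sum later allows cancelling an e-value of `A`. -/
theorem sum_lt_top (h : GuardInvariant c e n s) :
    ∑ i ∈ s.A ∪ s.U, e i < ⊤ := by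
  rcases (s.A ∪ s.U).eq_empty_or_nonempty with h0 | h0
  · simp [h0]
  · have hF : {i ∈ s.A ∪ s.U | i ≤ n} = s.A ∪ s.U :=
      filter_true_of_mem fun i hi => (h.lt_of_mem hi).le
    have := h.sum_lt n (by rwa [hF])
    rw [hF] at this
    exact this.trans_le le_top

/-- The largest e-value is at least the average, and those in `U` are below the threshold. -/
theorem threshold_le_of_max (h : GuardInvariant c e n s) {k : ℕ}
    (havg : c ≤ average e (insert n s.A ∪ s.U)) (hmax : ∀ j ∈ insert n s.A, e j ≤ e k) :
    c ≤ e k := by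
  have hne : (insert n s.A ∪ s.U).Nonempty := ⟨n, by simp⟩
  rw [le_average_iff hne] at havg
  by_contra! hk
  have hlt : ∀ i ∈ insert n s.A ∪ s.U, e i < c := by
    intro i hi
    rcases mem_union.1 hi with hi | hi
    · exact (hmax i hi).trans_lt hk
    · exact (h.mem_U.1 hi).2.2
  have : ∑ i ∈ insert n s.A ∪ s.U, e i < ∑ i ∈ insert n s.A ∪ s.U, c :=
    ENNReal.sum_lt_sum_of_nonempty hne hlt
  rw [sum_const, nsmul_eq_mul, mul_comm] at this
  exact absurd havg (not_le.2 this)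

theorem sum_lt_insert {F : Finset ℕ} {t : ℕ} (htF : t ∉ F)
    (hF : F.Nonempty → ∑ i ∈ F, e i < c * (F.card : ℝ≥0∞)) (ht : e t < c) :
    ∑ i ∈ insert t F, e i < c * ((insert t F).card : ℝ≥0∞) := by
  rw [sum_insert htF, card_insert_of_notMem htF]
  push_cast
  rw [mul_add, mul_one, add_comm]
  rcases F.eq_empty_or_nonempty with h0 | h0
  · simpa [h0] using ht
  · exact ENNReal.add_lt_add (hF h0) ht

theorem sum_lt_erase (hc : c ≠ ⊤) {F : Finset ℕ} {k : ℕ} (hkF : k ∈ F) (hk : c ≤ e k)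
    (hF : ∑ i ∈ F, e i < c * (F.card : ℝ≥0∞)) :
    ∑ i ∈ F.erase k, e i < c * ((F.erase k).card : ℝ≥0∞) := by
  rw [← add_sum_erase F e hkF, ← card_erase_add_one hkF] at hF
  push_cast at hF
  rw [mul_add, mul_one, add_comm _ c] at hF
  exact (ENNReal.add_lt_add_iff_left hc).1 ((add_le_add_left hk _).trans_lt hF)

/-- In a discovering pass, a truncation before `n` can only lose `k`, whose e-value is at least the
threshold. From `n` on, `n` takes the place of `k`: the cardinality is unchanged and the sum does
not grow, as `e n ≤ e k`. -/
theorem step {α : ℝ} (hα : 0 < α) {s' : GuardState}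
    (h : GuardInvariant (1 / ENNReal.ofReal α) e n s) (hs : GuardStep α e n s s') :
    GuardInvariant (1 / ENNReal.ofReal α) e (n + 1) s' := by
  have hc := threshold_ne_top hα
  have hnS : n ∉ s.S := fun hn => lt_irrefl _ (h.lt_of_mem_S hn)
  have hnA : n ∉ s.A := fun hn => hnS (h.A_subset hn)
  have hnU : n ∉ s.U := fun hn => lt_irrefl _ (h.mem_U.1 hn).1
  have hnAU : n ∉ s.A ∪ s.U := by simp [hnA, hnU]
  have hlow : ∀ m, m < n → ({i ∈ insert n s.A ∪ s.U | i ≤ m} = {i ∈ s.A ∪ s.U | i ≤ m}) := by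
    intro m hm
    ext i
    simp only [mem_filter, mem_union, mem_insert]
    constructor
    · rintro ⟨(rfl | hi) | hi, him⟩
      · omega
      · exact ⟨Or.inl hi, him⟩
      · exact ⟨Or.inr hi, him⟩
    · rintro ⟨hi | hi, him⟩
      · exact ⟨Or.inl (Or.inr hi), him⟩
      · exact ⟨Or.inr hi, him⟩
  have hall : ∀ m, n ≤ m → ({i ∈ s.A ∪ s.U | i ≤ m} = s.A ∪ s.U) := fun m hm =>
    filter_true_of_mem fun i hi => (h.lt_of_mem hi).le.trans hm
  have hall' : ∀ m, n ≤ m → ({i ∈ insert n s.A ∪ s.U | i ≤ m} = insert n s.A ∪ s.U) := by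
    intro m hm
    refine filter_true_of_mem fun i hi => ?_
    rw [insert_union, mem_insert] at hi
    rcases hi with rfl | hi
    · exact hm
    · exact (h.lt_of_mem hi).le.trans hm
  have hSsub : insert n s.S ⊆ range (n + 1) := by
    intro i hi
    rcases mem_insert.1 hi with rfl | hi
    · simp
    · have := h.lt_of_mem_S hi
      simp; omega
  have hSsub' : s.S ⊆ range (n + 1) := (subset_insert _ _).trans hSsub
  have hU : s.U = {i ∈ range (n + 1) | i ∉ insert n s.S ∧ e i < 1 / ENNReal.ofReal α} := by
    ext i
    rw [h.mem_U]
    simp only [mem_filter, mem_range, mem_insert]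
    constructor
    · rintro ⟨h1, h2, h3⟩
      exact ⟨by omega, by rintro (h4 | h4) <;> [omega; exact h2 h4], h3⟩
    · rintro ⟨h1, h2, h3⟩
      push Not at h2
      exact ⟨by omega, h2.2, h3⟩
  cases hs with
  | discover k havg hk hmax =>
    have hck := h.threshold_le_of_max havg hmax
    have hkU : k ∉ s.U := fun hkU => not_lt.2 hck (h.mem_U.1 hkU).2.2
    have hkS : k ∈ insert n s.S := insert_subset_insert n h.A_subset hk
    have hset : (insert n s.A).erase k ∪ s.U = (insert n s.A ∪ s.U).erase k := by
      rw [erase_union_distrib, erase_eq_of_notMem hkU]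
    refine ⟨hSsub, (erase_subset _ _).trans (insert_subset_insert n h.A_subset), hU, ?_, ?_⟩
    · show (insert n s.S \ (insert n s.A).erase k).card = s.d + 1
      rw [← h.card_eq, sdiff_erase hkS, card_insert_of_notMem (by simp [mem_insert.1 hk]),
        insert_sdiff_insert, sdiff_insert_of_notMem hnS]
    · intro m
      show {i ∈ (insert n s.A).erase k ∪ s.U | i ≤ m}.Nonempty → _
      dsimp only
      rw [hset, filter_erase]
      intro hne
      rcases lt_or_ge m n with hm | hm
      · rw [hlow m hm] at hne ⊢
        by_cases hkF : k ∈ {i ∈ s.A ∪ s.U | i ≤ m}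
        · exact sum_lt_erase hc hkF hck (h.sum_lt m ⟨k, hkF⟩)
        · rw [erase_eq_of_notMem hkF] at hne ⊢
          exact h.sum_lt m hne
      · rw [hall' m hm] at hne ⊢
        have hkF : k ∈ insert n s.A ∪ s.U := mem_union_left _ hk
        have hcard : ((insert n s.A ∪ s.U).erase k).card = (s.A ∪ s.U).card := by
          rw [card_erase_of_mem hkF, insert_union, card_insert_of_notMem hnAU,
            Nat.add_sub_cancel]
        have hne' : (s.A ∪ s.U).Nonempty := by
          rw [← card_pos, ← hcard]; exact hne.card_pos
        have hlt := h.sum_lt m (by rwa [hall m hm])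
        rw [hall m hm] at hlt
        rw [hcard]
        refine lt_of_le_of_lt ?_ hlt
        by_cases hkn : k = n
        · subst hkn
          rw [insert_union, erase_insert hnAU]
        · have hkAU : k ∈ s.A ∪ s.U :=
            mem_union_left _ ((mem_insert.1 hk).resolve_left hkn)
          rw [insert_union, erase_insert_of_ne (Ne.symm hkn),
            sum_insert (fun hh => hnAU (mem_of_mem_erase hh)), ← add_sum_erase _ e hkAU]
          exact add_le_add_left (hmax n (mem_insert_self _ _)) _
  | keep havg =>
    refine ⟨hSsub, insert_subset_insert n h.A_subset, hU, ?_, ?_⟩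
    · show (insert n s.S \ insert n s.A).card = s.d
      rw [← h.card_eq, insert_sdiff_insert, sdiff_insert_of_notMem hnS]
    · intro m hne
      dsimp only at hne ⊢
      rcases lt_or_ge m n with hm | hm
      · rw [hlow m hm] at hne ⊢
        exact h.sum_lt m hne
      · rw [hall' m hm] at hne ⊢
        exact (average_lt_iff hne).1 havg
  | small he =>
    refine ⟨hSsub', h.A_subset, ?_, h.card_eq, ?_⟩
    · ext i
      simp only [mem_insert, h.mem_U, mem_filter, mem_range]
      constructor
      · rintro (rfl | ⟨h1, h2⟩)
        · exact ⟨by omega, hnS, he⟩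
        · exact ⟨by omega, h2⟩
      · rintro ⟨h1, h2⟩
        by_cases hin : i = n
        · exact Or.inl hin
        · exact Or.inr ⟨by omega, h2⟩
    · intro m hne
      dsimp only at hne ⊢
      rw [union_insert, ← insert_union] at hne ⊢
      rcases lt_or_ge m n with hm | hm
      · rw [hlow m hm] at hne ⊢
        exact h.sum_lt m hne
      · rw [hall' m hm, insert_union]
        refine sum_lt_insert hnAU ?_ he
        have := h.sum_lt m
        rwa [hall m hm] at this
  | large he =>
    refine ⟨hSsub', h.A_subset, ?_, h.card_eq, h.sum_lt⟩
    ext i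
    simp only [h.mem_U, mem_filter, mem_range]
    constructor
    · rintro ⟨h1, h2⟩
      exact ⟨by omega, h2⟩
    · rintro ⟨h1, h2⟩
      refine ⟨lt_of_le_of_ne (Nat.lt_succ_iff.1 h1) ?_, h2⟩
      rintro rfl
      exact not_lt.2 he h2.2

end GuardInvariant

/-! ### Greedy optimality and comparison with unrejected sets -/

section Run

variable {α : ℝ} {e : ℕ → ℝ≥0∞} {s : ℕ → GuardState}

theorem IsGuardRun.invariant (hα : 0 < α) (hs : IsGuardRun α e s) (n : ℕ) :
    GuardInvariant (1 / ENNReal.ofReal α) e n (s n) := by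
  induction n with
  | zero =>
    rw [hs.1]
    exact ⟨by simp, by simp, by simp, by simp, by simp⟩
  | succ n ih => exact ih.step hα (hs.2 n)

theorem GuardStep.S_eq_or {t : ℕ} {a b : GuardState} (h : GuardStep α e t a b) :
    b.S = a.S ∨ b.S = insert t a.S := by
  cases h <;> simp

theorem IsGuardRun.mem_S_iff (hα : 0 < α) (hs : IsGuardRun α e s) {t n : ℕ} (htn : t ≤ n)
    {i : ℕ} : i ∈ (s t).S ↔ i ∈ (s n).S ∧ i < t := by
  induction n, htn using Nat.le_induction with
  | base => exact ⟨fun h => ⟨h, (hs.invariant hα t).lt_of_mem_S h⟩, fun h => h.1⟩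
  | succ n htn ih =>
    rw [ih]
    rcases (hs.2 n).S_eq_or with h | h <;> rw [h]
    rw [mem_insert]
    constructor
    · exact fun h => ⟨Or.inr h.1, h.2⟩
    · rintro ⟨rfl | h, hi⟩
      · omega
      · exact ⟨h, hi⟩

/-- Excluded indices stay excluded. -/
theorem IsGuardRun.excluded_mono (hα : 0 < α) (hs : IsGuardRun α e s) :
    Monotone fun n => (s n).S \ (s n).A := by
  refine monotone_nat_of_le_succ fun n => ?_
  have hnS : n ∉ (s n).S := fun hn => lt_irrefl _ ((hs.invariant hα n).lt_of_mem_S hn)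
  intro i hi
  have hin : i ≠ n := by rintro rfl; exact hnS (mem_sdiff.1 hi).1
  have hstep := hs.2 n
  generalize s (n + 1) = s' at hstep
  cases hstep <;> simp_all

/-- Among all sets of `d` queried indices that contain at least `d t` indices queried before
each time `t`, the excluded one leaves the smallest sum of e-values. -/
theorem IsGuardRun.sum_le (hα : 0 < α) (hs : IsGuardRun α e s) (n : ℕ) (X : Finset ℕ)
    (hX : X ⊆ (s n).S) (hcard : X.card = (s n).d)
    (hfeas : ∀ t ≤ n, (s t).d ≤ (X ∩ (s t).S).card) :
    ∑ i ∈ (s n).A, e i ≤ ∑ i ∈ (s n).S \ X, e i := by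
  induction n generalizing X with
  | zero => simp [hs.1]
  | succ n ih =>
    have hinv := hs.invariant hα n
    have hnS : n ∉ (s n).S := fun hn => lt_irrefl _ (hinv.lt_of_mem_S hn)
    have hnA : n ∉ (s n).A := fun hn => hnS (hinv.A_subset hn)
    have hfeas' : ∀ t ≤ n, (s t).d ≤ (X ∩ (s t).S).card := fun t ht => hfeas t (by omega)
    have hnSt : ∀ t ≤ n, n ∉ (s t).S := fun t ht hn => hnS ((hs.mem_S_iff hα ht).1 hn).1
    clear hfeas
    have hstep := hs.2 n
    generalize s (n + 1) = s' at hX hcard hstep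
    cases hstep with
    | discover k havg hk hmax =>
      dsimp only at hX hcard ⊢
      -- If `n ∈ X`, dropping `n` keeps feasibility, as `n` lies in no earlier query set; what
      -- remains is `e n ≤ e k`.
      by_cases hnX : n ∈ X
      · have hX' : X.erase n ⊆ (s n).S := by
          intro i hi
          exact (mem_insert.1 (hX (mem_of_mem_erase hi))).resolve_left (ne_of_mem_erase hi)
        have hle := ih (X.erase n) hX' (by rw [card_erase_of_mem hnX, hcard]; rfl) (by
          intro t ht
          rw [erase_inter, erase_eq_of_notMem (fun hh => hnSt t ht (mem_inter.1 hh).2)]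
          exact hfeas' t ht)
        have hset : insert n (s n).S \ X = (s n).S \ X.erase n := by
          ext i
          simp only [mem_sdiff, mem_insert, mem_erase]
          constructor
          · rintro ⟨rfl | h1, h2⟩
            · exact absurd hnX h2
            · exact ⟨h1, fun h => h2 h.2⟩
          · rintro ⟨h1, h2⟩
            refine ⟨Or.inr h1, fun h => h2 ⟨?_, h⟩⟩
            rintro rfl
            exact hnS h1
        rw [hset]
        refine le_trans ?_ hle
        by_cases hkn : k = n
        · subst hkn
          rw [erase_insert hnA]
        · have hkA : k ∈ (s n).A := (mem_insert.1 hk).resolve_left hkn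
          rw [erase_insert_of_ne (Ne.symm hkn),
            sum_insert (fun hh => hnA (mem_of_mem_erase hh)), ← add_sum_erase _ e hkA]
          exact add_le_add_left (hmax n (mem_insert_self _ _)) _
      · have hXS : X ⊆ (s n).S := fun i hi =>
          (mem_insert.1 (hX hi)).resolve_left (by rintro rfl; exact hnX hi)
        -- `X` has one element more than the old excluded set. The latest element `y` of `X` outside
        -- it is given back.
        have hne : (X \ ((s n).S \ (s n).A)).Nonempty := by
          rw [← card_pos]
          have := le_card_sdiff ((s n).S \ (s n).A) X
          rw [hinv.card_eq, hcard] at this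
          omega
        obtain ⟨y, hy, hymax⟩ := exists_max_image _ id hne
        obtain ⟨hyX, hyR⟩ := mem_sdiff.1 hy
        have hyA : y ∈ (s n).A := by
          by_contra h
          exact hyR (mem_sdiff.2 ⟨hXS hyX, h⟩)
        have hle := ih (X.erase y) ((erase_subset _ _).trans hXS)
          (by rw [card_erase_of_mem hyX, hcard]; rfl) (by
            intro t ht
            by_cases hyt : y ∈ (s t).S
            · have hyt' := ((hs.mem_S_iff hα ht).1 hyt).2
              -- By maximality of `y`, every element of `X` not yet queried at `t` was excluded by
              -- the algorithm after `t`. There are at most `(s n).d - (s t).d` of these, so `X ∩ (s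
              -- t).S` has an element to spare.
              have h1 : X \ (s t).S ⊆ ((s n).S \ (s n).A) \ ((s t).S \ (s t).A) := by
                intro i hi
                obtain ⟨hiX, hit⟩ := mem_sdiff.1 hi
                refine mem_sdiff.2 ⟨?_, fun h => hit (mem_sdiff.1 h).1⟩
                by_contra hiR
                have : i ≤ y := hymax i (mem_sdiff.2 ⟨hiX, hiR⟩)
                exact hit ((hs.mem_S_iff hα ht).2 ⟨hXS hiX, by omega⟩)
              have h2 := card_le_card h1
              have h3 : (s t).S \ (s t).A ⊆ (s n).S \ (s n).A := hs.excluded_mono hα ht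
              have h4 := card_le_card h3
              rw [card_sdiff_of_subset h3] at h2
              rw [(hs.invariant hα t).card_eq, hinv.card_eq] at h2 h4
              have h5 := card_inter_add_card_sdiff X (s t).S
              rw [erase_inter, card_erase_of_mem (mem_inter.2 ⟨hyX, hyt⟩)]
              omega
            · rw [erase_inter, erase_eq_of_notMem (fun hh => hyt (mem_inter.1 hh).2)]
              exact hfeas' t ht)
        have hset1 : (s n).S \ X.erase y = insert y ((s n).S \ X) := sdiff_erase (hXS hyX)
        have hset2 : insert n (s n).S \ X = insert n ((s n).S \ X) :=
          insert_sdiff_of_notMem _ hnX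
        rw [hset1, sum_insert (by simp [hyX])] at hle
        rw [hset2, sum_insert (by simp [hnS])]
        have hyk : e y ≤ e k := hmax y (mem_insert_of_mem hyA)
        by_cases hkn : k = n
        · subst hkn
          rw [erase_insert hnA]
          exact hle.trans (add_le_add_left hyk _)
        · have hkA : k ∈ (s n).A := (mem_insert.1 hk).resolve_left hkn
          have hktop : e k ≠ ⊤ := by
            refine ne_of_lt (lt_of_le_of_lt ?_ hinv.sum_lt_top)
            exact single_le_sum (f := e) (fun _ _ => zero_le) (mem_union_left _ hkA)
          rw [erase_insert_of_ne (Ne.symm hkn),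
            sum_insert (fun hh => hnA (mem_of_mem_erase hh))]
          rw [← add_sum_erase _ e hkA] at hle
          refine add_le_add_right ?_ _
          exact (ENNReal.add_le_add_iff_left hktop).1 (hle.trans (add_le_add_left hyk _))
    | keep havg =>
      dsimp only at hX hcard ⊢
      -- Feasibility at `n` already places all of `X` among the earlier queries.
      have hnX : n ∉ X := by
        intro hnX
        have h1 : X ∩ (s n).S ⊆ X.erase n := fun i hi =>
          mem_erase.2 ⟨by rintro rfl; exact hnS (mem_inter.1 hi).2, (mem_inter.1 hi).1⟩
        have h2 := card_le_card h1
        rw [card_erase_of_mem hnX] at h2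
        have h3 := hfeas' n le_rfl
        have h4 : 0 < X.card := card_pos.2 ⟨n, hnX⟩
        omega
      have hXS : X ⊆ (s n).S := fun i hi =>
        (mem_insert.1 (hX hi)).resolve_left (by rintro rfl; exact hnX hi)
      rw [insert_sdiff_of_notMem _ hnX, sum_insert hnA, sum_insert (by simp [hnS])]
      exact add_le_add_right (ih X hXS hcard hfeas') _
    | small he => exact ih X hX hcard hfeas'
    | large he => exact ih X hX hcard hfeas'

theorem IsGuardRun.le_card_sdiff (hα : 0 < α) (hs : IsGuardRun α e s) {I : Set ℕ}
    (hI : ∀ t ∈ I, average e (upTo I t) < 1 / ENNReal.ofReal α) (n : ℕ) :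
    (s n).d ≤ (((s n).S : Set ℕ) \ I).ncard := by
  classical
  have hcoe : ∀ F : Finset ℕ, ((F : Set ℕ) \ I).ncard = (F.filter (· ∉ I)).card := by
    intro F
    rw [← Set.ncard_coe_finset]
    congr 1
    ext i
    simp
  rw [hcoe]
  induction n using Nat.strong_induction_on with
  | _ n ih =>
  rcases n with _ | n
  · simp [hs.1]
  have hc := threshold_ne_top hα
  have hinv := hs.invariant hα n
  have hnS : n ∉ (s n).S := fun hn => lt_irrefl _ (hinv.lt_of_mem_S hn)
  have hn := ih n (by omega)
  have hstep := hs.2 n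
  generalize hs' : s (n + 1) = s' at hstep
  clear hs'
  have hmono : ((s n).S.filter (· ∉ I)).card ≤ ((insert n (s n).S).filter (· ∉ I)).card :=
    card_le_card (filter_subset_filter _ (subset_insert _ _))
  cases hstep with
  | keep havg => exact hn.trans hmono
  | small he => exact hn
  | large he => exact hn
  | discover k havg hk hmax =>
    dsimp only
    by_cases hnI : n ∉ I
    · rw [filter_insert, if_pos hnI, card_insert_of_notMem (by simp [hnS])]
      omega
    push Not at hnI
    by_contra! hlt
    set X := (s n).S.filter (· ∉ I) with hX
    have hcard : X.card = (s n).d := by omega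
    have hsum := hs.sum_le hα n X (filter_subset _ _) hcard (by
      intro t ht
      -- Feasibility of `X` is the claim at all earlier times, hence the strong induction.
      refine (ih t (by omega)).trans (card_le_card fun i hi => ?_)
      obtain ⟨h1, h2⟩ := mem_filter.1 hi
      exact mem_inter.2 ⟨mem_filter.2 ⟨((hs.mem_S_iff hα ht).1 h1).1, h2⟩, h1⟩)
    have hcardA : ((s n).S \ X).card = (s n).A.card := by
      have h1 := card_sdiff_add_card_eq_card (filter_subset (· ∉ I) (s n).S)
      have h2 := card_sdiff_add_card_eq_card hinv.A_subset
      rw [hinv.card_eq] at h2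
      rw [← hX] at h1
      omega
    set c := 1 / ENNReal.ofReal α with hcdef
    set V : Finset ℕ := {i ∈ range n | i ∉ (s n).S ∧ i ∈ I} with hV
    have hupTo : upTo I n = insert n (((s n).S \ X) ∪ V) := by
      ext i
      simp only [mem_upTo, mem_insert, mem_union, mem_sdiff, hX, hV, mem_filter, mem_range]
      constructor
      · rintro ⟨h1, h2⟩
        by_cases h3 : i = n
        · exact Or.inl h3
        · by_cases h4 : i ∈ (s n).S
          · exact Or.inr (Or.inl ⟨h4, fun h => h.2 h2⟩)
          · exact Or.inr (Or.inr ⟨by omega, h4, h2⟩)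
      · rintro (rfl | ⟨h1, h2⟩ | ⟨h1, h2, h3⟩)
        · exact ⟨le_rfl, hnI⟩
        · exact ⟨(hinv.lt_of_mem_S h1).le, by_contra fun h => h2 ⟨h1, h⟩⟩
        · exact ⟨h1.le, h3⟩
    have hnotin : n ∉ ((s n).S \ X) ∪ V := by simp [hnS, hV]
    have hdisj : Disjoint ((s n).S \ X) V := by
      rw [disjoint_left]
      intro i hi hiV
      exact (mem_filter.1 hiV).2.1 (mem_sdiff.1 hi).1
    have hAU : Disjoint (s n).A (s n).U := by
      rw [disjoint_left]
      intro i hi hiU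
      exact (hinv.mem_U.1 hiU).2.1 (hinv.A_subset hi)
    have hnAU : n ∉ (s n).A ∪ (s n).U := fun h => lt_irrefl _ (hinv.lt_of_mem h)
    have h1 := (average_lt_iff (upTo_nonempty hnI)).1 (hI n hnI)
    refine absurd h1 (not_lt.2 ?_)
    rw [le_average_iff ⟨n, by simp⟩, insert_union, sum_insert hnAU, card_insert_of_notMem hnAU,
      sum_union hAU, card_union_of_disjoint hAU] at havg
    rw [hupTo, sum_insert hnotin, card_insert_of_notMem hnotin, sum_union hdisj,
      card_union_of_disjoint hdisj, hcardA]
    -- Unqueried indices outside `U` have e-values at least `c`, those in `U` less than `c`; so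
    -- exchanging `U` for `V` cannot push the average below `c`.
    have hVU : c * ((V \ (s n).U).card : ℝ≥0∞) ≤ ∑ i ∈ V \ (s n).U, e i := by
      rw [mul_comm, ← nsmul_eq_mul, ← sum_const]
      refine sum_le_sum fun i hi => ?_
      obtain ⟨hiV, hiU⟩ := mem_sdiff.1 hi
      obtain ⟨h2, h3, -⟩ := mem_filter.1 hiV
      by_contra! h4
      exact hiU (hinv.mem_U.2 ⟨mem_range.1 h2, h3, h4⟩)
    have hUV : ∑ i ∈ (s n).U \ V, e i ≤ c * (((s n).U \ V).card : ℝ≥0∞) := by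
      rw [mul_comm, ← nsmul_eq_mul, ← sum_const]
      exact sum_le_sum fun i hi => (hinv.mem_U.1 (mem_sdiff.1 hi).1).2.2.le
    have hU1 := sum_inter_add_sum_sdiff (s n).U V e
    have hU2 := card_inter_add_card_sdiff (s n).U V
    have hV1 := sum_inter_add_sum_sdiff V (s n).U e
    have hV2 := card_inter_add_card_sdiff V (s n).U
    rw [inter_comm] at hV1 hV2
    rw [← hU1, ← hU2] at havg
    rw [← hV1, ← hV2]
    -- A finite term is added on both sides to avoid truncated subtraction.
    have hfin : c * (((s n).U \ V).card : ℝ≥0∞) ≠ ⊤ :=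
      ENNReal.mul_ne_top hc (ENNReal.natCast_ne_top _)
    push_cast at havg ⊢
    simp only [mul_add, mul_one] at havg ⊢
    rw [← ENNReal.add_le_add_iff_right hfin]
    calc _ = (c * (s n).A.card + (c * ((s n).U ∩ V).card + c * ((s n).U \ V).card) + c)
            + c * (V \ (s n).U).card := by ring
      _ ≤ (e n + (∑ i ∈ (s n).A, e i + (∑ i ∈ (s n).U ∩ V, e i + ∑ i ∈ (s n).U \ V, e i)))
            + ∑ i ∈ V \ (s n).U, e i := add_le_add havg hVU
      _ ≤ (e n + (∑ i ∈ (s n).S \ X, e i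
            + (∑ i ∈ (s n).U ∩ V, e i + c * (((s n).U \ V).card : ℝ≥0∞))))
            + ∑ i ∈ V \ (s n).U, e i := by gcongr
      _ = _ := by ring

/-- The set of the not excluded and of the small unqueried indices is not rejected. -/
theorem IsGuardRun.average_lt (hα : 0 < α) (hs : IsGuardRun α e s) (n : ℕ) :
    ∀ t ∈ (((s n).A ∪ (s n).U : Finset ℕ) : Set ℕ),
      average e (upTo (((s n).A ∪ (s n).U : Finset ℕ) : Set ℕ) t) < 1 / ENNReal.ofReal α := by
  intro t ht
  have hset : upTo (((s n).A ∪ (s n).U : Finset ℕ) : Set ℕ) t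
      = {i ∈ (s n).A ∪ (s n).U | i ≤ t} := by
    ext i
    rw [mem_upTo, mem_filter, mem_coe, and_comm]
  have hne := upTo_nonempty ht
  rw [average_lt_iff hne, hset]
  exact (hs.invariant hα n).sum_lt t (hset ▸ hne)

end Run

theorem not_exeTest_iff {Ω : Type*} {α : ℝ} {E : ℕ → Ω → ℝ≥0∞} {I : Set ℕ} {ω : Ω} :
    ¬ exeTest α E I ω ↔
      ∀ t ∈ I, average (fun i => E i ω) (upTo I t) < 1 / ENNReal.ofReal α := by
  simp only [exeTest, not_exists, not_and, not_le]

theorem closedProcedure_le {Ω : Type*} {φ : Set ℕ → Ω → Prop} {ω : Ω} {I : Set ℕ}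
    (hI : ¬ φ I ω) (S : Finset ℕ) : closedProcedure φ S ω ≤ ((S : Set ℕ) \ I).ncard :=
  Nat.sInf_le ⟨I, hI, rfl⟩

theorem IsGuardRun.d_eq_closedProcedure {Ω : Type*} {α : ℝ} (hα : 0 < α) {E : ℕ → Ω → ℝ≥0∞}
    {ω : Ω} {s : ℕ → GuardState} (hs : IsGuardRun α (fun t => E t ω) s) (n : ℕ) :
    (s n).d = closedProcedure (exeTest α E) (s n).S ω := by
  apply le_antisymm
  · refine le_csInf ⟨_, ∅, not_exeTest_empty α E ω, rfl⟩ ?_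
    rintro _ ⟨I, hI, rfl⟩
    exact hs.le_card_sdiff hα (not_exeTest_iff.1 hI) n
  · refine (closedProcedure_le (not_exeTest_iff.2 (hs.average_lt hα n)) _).trans ?_
    have hinv := hs.invariant hα n
    rw [← hinv.card_eq, ← Set.ncard_coe_finset]
    refine Set.ncard_le_ncard (fun i hi => ?_) (Set.toFinite _)
    simp only [Set.mem_sdiff, mem_coe, mem_union, not_or, mem_sdiff] at hi ⊢
    exact ⟨hi.1, hi.2.1⟩

end OnlineDiscovery

namespace OnlineDiscovery

/-! ### Measurability and the guarantee of the closed procedure -/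

section Measurability

variable {Ω : Type*} {m : MeasurableSpace Ω}

theorem measurable_average {β : Type*} [MeasurableSpace β] {X : ℕ → β → ℝ≥0∞} {F : Finset ℕ}
    (hX : ∀ i ∈ F, Measurable (X i)) : Measurable fun b => average (fun i => X i b) F := by
  unfold average
  exact (Finset.measurable_fun_sum F hX).div_const _

theorem measurableSet_le_average {β : Type*} [MeasurableSpace β] {X : ℕ → β → ℝ≥0∞}
    {F : Finset ℕ} (hX : ∀ i ∈ F, Measurable (X i)) (c : ℝ≥0∞) :
    MeasurableSet {b | c ≤ average (fun i => X i b) F} :=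
  measurableSet_le measurable_const (measurable_average hX)

theorem measurable_nat_of_le {β : Type*} [MeasurableSpace β] {f : β → ℕ}
    (hf : ∀ n, MeasurableSet {b | f b ≤ n}) : Measurable f :=
  measurable_of_Iic hf

theorem isOnlineTests_exeTest {ℱ : Filtration ℕ m} {E : ℕ → Ω → ℝ≥0∞} (α : ℝ)
    (hmeas : ∀ t, Measurable[ℱ t] (E t)) : IsOnlineTests ℱ (exeTest α E) := by
  intro I
  have hset : {ω | exeTest α E I ω} =
      ⋃ t ∈ I, {ω | 1 / ENNReal.ofReal α ≤ average (fun i => E i ω) (upTo I t)} := by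
    ext ω
    simp [exeTest]
  rw [hset]
  refine MeasurableSet.biUnion (Set.to_countable I) fun t _ => ?_
  refine @measurableSet_le_average _ (⨆ i ∈ I, ℱ i) E _ (fun i hi => ?_) _
  exact (hmeas i).mono (le_iSup₂ (f := fun i (_ : i ∈ I) => ℱ i) i (mem_upTo.1 hi).2) le_rfl

theorem isIncreasing_exeTest (α : ℝ) (E : ℕ → Ω → ℝ≥0∞) : IsIncreasing (exeTest α E) := by
  rintro i I K hI hK ω ⟨t, ht, h⟩
  refine ⟨t, Or.inl ht, ?_⟩
  have hset : upTo (I ∪ K) t = upTo I t := by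
    ext j
    simp only [mem_upTo, Set.mem_union]
    refine ⟨fun ⟨h1, h2⟩ => ⟨h1, h2.resolve_right fun hj => ?_⟩, fun ⟨h1, h2⟩ => ⟨h1, Or.inl h2⟩⟩
    have h3 : i < j := hK hj
    have h4 : t ≤ i := hI ht
    omega
  rwa [hset]

/-- In the closed procedure of an increasing family only finite sets up to the maximum of `S`
matter. -/
theorem IsIncreasing.closedProcedure_le_iff {φ : Set ℕ → Ω → Prop} (hφ : IsIncreasing φ)
    {S : Finset ℕ} {i : ℕ} (hS : ∀ j ∈ S, j ≤ i) {ω : Ω} (h0 : ¬ φ ∅ ω) (n : ℕ) :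
    closedProcedure φ S ω ≤ n ↔
      ∃ F : Finset ℕ, ((F : Set ℕ) ⊆ Set.Iic i ∧ ((S : Set ℕ) \ F).ncard ≤ n) ∧ ¬ φ F ω := by
  constructor
  · intro h
    obtain ⟨I, hI, hd⟩ := Nat.sInf_mem
      (⟨_, ∅, h0, rfl⟩ : {n | ∃ I : Set ℕ, ¬ φ I ω ∧ n = ((S : Set ℕ) \ I).ncard}.Nonempty)
    change closedProcedure φ S ω = _ at hd
    have hfin : (I ∩ Set.Iic i).Finite := (Set.finite_Iic i).inter_of_right I
    refine ⟨hfin.toFinset, ⟨by simp, ?_⟩, ?_⟩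
    · rw [hd] at h
      convert h using 2
      ext j
      have := hS j
      simp only [hfin.coe_toFinset, Set.mem_sdiff, Finset.mem_coe, Set.mem_inter_iff, Set.mem_Iic]
      tauto
    · rw [hfin.coe_toFinset]
      intro h1
      have := hφ i (I ∩ Set.Iic i) (I ∩ Set.Ioi i) Set.inter_subset_right Set.inter_subset_right
        ω h1
      rw [← Set.inter_union_distrib_left, Set.Iic_union_Ioi, Set.inter_univ] at this
      exact hI this
  · rintro ⟨F, ⟨-, hF⟩, h⟩
    exact (closedProcedure_le h S).trans hF

theorem IsIncreasing.isOnlineProcedure {ℱ : Filtration ℕ m} {φ : Set ℕ → Ω → Prop}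
    (hφ : IsIncreasing φ) (hon : IsOnlineTests ℱ φ) (h0 : ∀ ω, ¬ φ ∅ ω) :
    IsOnlineProcedure ℱ (closedProcedure φ) := by
  intro S
  rcases S.eq_empty_or_nonempty with rfl | hS
  · have hz : closedProcedure φ ∅ = fun _ => 0 := by
      ext ω
      simpa using closedProcedure_le (h0 ω) ∅
    rw [hz]
    exact measurable_const
  · have hle : ∀ j ∈ S, j ≤ S.max' hS := fun j hj => S.le_max' j hj
    refine @measurable_nat_of_le _ (⨆ i ∈ S, ℱ i) _ fun n => ?_
    have hset : {ω | closedProcedure φ S ω ≤ n} =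
        ⋃ F ∈ {F : Finset ℕ | (F : Set ℕ) ⊆ Set.Iic (S.max' hS) ∧
          ((S : Set ℕ) \ F).ncard ≤ n}, {ω | φ F ω}ᶜ := by
      ext ω
      rw [Set.mem_ofPred_eq, hφ.closedProcedure_le_iff hle (h0 ω) n]
      simp only [Set.mem_iUnion, Set.mem_ofPred_eq, Set.mem_compl_iff, exists_prop]
    rw [hset]
    refine MeasurableSet.biUnion (Set.to_countable _) fun F hF => MeasurableSet.compl ?_
    have h1 : (⨆ i ∈ (F : Set ℕ), (ℱ i : MeasurableSpace Ω)) ≤ ℱ (S.max' hS) :=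
      iSup₂_le fun i hi => ℱ.mono (hF.1 hi)
    have h2 : (ℱ (S.max' hS) : MeasurableSpace Ω) ≤ ⨆ i ∈ S, ℱ i :=
      le_iSup₂ (f := fun i (_ : i ∈ S) => (ℱ i : MeasurableSpace Ω)) _ (S.max'_mem hS)
    exact h2 _ (h1 _ (hon F))

/-- When the set of true nulls is not rejected, it competes in the infimum for every `S` at once; no
union bound is needed. -/
theorem hasTrueDiscoveryGuarantee_closedProcedure {ℱ : Filtration ℕ m}
    {𝓜 : Set (ProbabilityMeasure Ω)} {H : ℕ → Set (ProbabilityMeasure Ω)} {α : ℝ} (hα : 0 < α)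
    {φ : Set ℕ → Ω → Prop} (hlevel : IsLevelTests 𝓜 H α φ) (hon : IsOnlineTests ℱ φ) :
    HasTrueDiscoveryGuarantee 𝓜 H α (closedProcedure φ) := by
  intro P hP
  have hm : MeasurableSet {ω | φ (trueNulls H P) ω} :=
    (iSup₂_le fun i _ => ℱ.le i : (⨆ i ∈ trueNulls H P, ℱ i) ≤ m) _ (hon _)
  have hsub : {ω | φ (trueNulls H P) ω}ᶜ ⊆ {ω | ∀ S : Finset ℕ,
      closedProcedure φ S ω ≤ ((S : Set ℕ) ∩ falseNulls H P).ncard} :=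
    fun ω hω S => closedProcedure_le hω S
  refine le_trans ?_ (measure_mono hsub)
  rw [prob_compl_eq_one_sub hm, ENNReal.ofReal_sub _ hα.le, ENNReal.ofReal_one]
  exact tsub_le_tsub_left (hlevel _ P ⟨hP, fun i hi => hi⟩) _

end Measurability

/-! ### Maximal inequality for exchangeable e-values -/

section MaximalInequality

variable {Ω : Type*} {m : MeasurableSpace Ω} {P : Measure Ω} {E : ℕ → Ω → ℝ≥0∞} {N : Set ℕ}

/-- Exchangeability concerns families indexed by `N` only. Padding by zeros transfers it to
functionals of full sequences, harmlessly since `G` ignores coordinates outside `N`. -/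
theorem Exchangeable.lintegral_swap (h : Exchangeable (fun t : N => E t) P)
    (hE : ∀ t, Measurable (E t)) {i j : ℕ} (hi : i ∈ N) (hj : j ∈ N)
    {G : (ℕ → ℝ≥0∞) → ℝ≥0∞} (hG : Measurable G)
    (hdep : ∀ x y : ℕ → ℝ≥0∞, (∀ k ∈ N, x k = y k) → G x = G y) :
    ∫⁻ ω, G (fun k => E (Equiv.swap i j k) ω) ∂P = ∫⁻ ω, G (fun k => E k ω) ∂P := by
  classical
  let pad : (N → ℝ≥0∞) → ℕ → ℝ≥0∞ := fun x k => if hk : k ∈ N then x ⟨k, hk⟩ else 0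
  have hpad : Measurable pad := by
    refine measurable_pi_lambda _ fun k => ?_
    by_cases hk : k ∈ N
    · simpa only [pad, hk, dite_true] using measurable_pi_apply _
    · simpa only [pad, hk, dite_false] using measurable_const
  let σ : Equiv.Perm N := Equiv.swap ⟨i, hi⟩ ⟨j, hj⟩
  have hσ : {k | σ k ≠ k}.Finite := by
    refine Set.Finite.subset (Set.toFinite {⟨i, hi⟩, ⟨j, hj⟩}) fun k hk => ?_
    by_contra hne
    simp only [Set.mem_insert_iff, Set.mem_singleton_iff, not_or] at hne
    exact hk (Equiv.swap_apply_of_ne_of_ne hne.1 hne.2)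
  have hσ_coe : ∀ k : N, ((σ k : N) : ℕ) = Equiv.swap i j k := by
    intro k
    simp only [σ, Equiv.swap_apply_def, Subtype.ext_iff]
    split_ifs <;> rfl
  have hmap := congrArg (fun ν => ∫⁻ x, G (pad x) ∂ν) (h σ hσ)
  have hGpad : Measurable fun x => G (pad x) := hG.comp hpad
  dsimp only at hmap
  rw [lintegral_map hGpad (measurable_pi_lambda _ fun k => hE _),
    lintegral_map hGpad (measurable_pi_lambda _ fun k => hE _)] at hmap
  refine Eq.trans (lintegral_congr fun ω => ?_) (hmap.trans (lintegral_congr fun ω => ?_))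
  · refine hdep _ _ fun k hk => ?_
    simp only [pad, hk, dite_true, hσ_coe]
  · refine hdep _ _ fun k hk => ?_
    simp only [pad, hk, dite_true]

/-- The sequences whose last running average over `I` up to time `M` reaching `c` is the one at
time `t`. -/
def lastCrossing (c : ℝ≥0∞) (I : Set ℕ) (M t : ℕ) : Set (ℕ → ℝ≥0∞) :=
  {x | c ≤ average x (upTo I t) ∧ ∀ u ∈ I, t < u → u ≤ M → average x (upTo I u) < c}

theorem measurableSet_lastCrossing (c : ℝ≥0∞) (I : Set ℕ) (M t : ℕ) :
    MeasurableSet (lastCrossing c I M t) := by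
  have havg : ∀ u, Measurable fun x : ℕ → ℝ≥0∞ => average x (upTo I u) := fun u =>
    measurable_average fun i _ => measurable_pi_apply i
  have hset : lastCrossing c I M t = {x | c ≤ average x (upTo I t)} ∩
      ⋂ (u : ℕ) (_ : u ∈ I) (_ : t < u) (_ : u ≤ M), {x | average x (upTo I u) < c} := by
    ext x
    simp [lastCrossing]
  rw [hset]
  refine (measurableSet_le measurable_const (havg t)).inter ?_
  exact MeasurableSet.iInter fun u => MeasurableSet.iInter fun _ => MeasurableSet.iInter fun _ =>
    MeasurableSet.iInter fun _ => measurableSet_lt (havg u) measurable_const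

theorem average_congr {x y : ℕ → ℝ≥0∞} {F : Finset ℕ} (h : ∀ i ∈ F, x i = y i) :
    average x F = average y F := by
  rw [average, average, Finset.sum_congr rfl h]

theorem average_swap (x : ℕ → ℝ≥0∞) {I : Set ℕ} {i j t : ℕ} (hi : i ∈ upTo I t)
    (hj : j ∈ upTo I t) : average (fun k => x (Equiv.swap i j k)) (upTo I t) =
      average x (upTo I t) := by
  have hmem : ∀ k ∈ upTo I t, Equiv.swap i j k ∈ upTo I t := by
    intro k hk
    rw [Equiv.swap_apply_def]
    split_ifs <;> assumption
  rw [average, average]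
  congr 1
  exact Finset.sum_nbij' (Equiv.swap i j) (Equiv.swap i j) hmem hmem (by simp) (by simp)
    (by simp)

/-- Only averages from `t` on matter, and these contain both swapped indices. A first crossing would
involve earlier averages and lose this symmetry. -/
theorem swap_mem_lastCrossing_iff {c : ℝ≥0∞} {I : Set ℕ} {M t i j : ℕ} (hi : i ∈ upTo I t)
    (hj : j ∈ upTo I t) (x : ℕ → ℝ≥0∞) :
    (fun k => x (Equiv.swap i j k)) ∈ lastCrossing c I M t ↔ x ∈ lastCrossing c I M t := by
  have hmono : ∀ {k u}, t ≤ u → k ∈ upTo I t → k ∈ upTo I u := fun htu hk =>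
    mem_upTo.2 ⟨(mem_upTo.1 hk).1.trans htu, (mem_upTo.1 hk).2⟩
  simp only [lastCrossing, Set.mem_ofPred_eq, average_swap x hi hj]
  refine and_congr_right fun _ => forall₃_congr fun u _ htu => ?_
  rw [average_swap x (hmono htu.le hi) (hmono htu.le hj)]

theorem mem_lastCrossing_congr {c : ℝ≥0∞} {I : Set ℕ} {M t : ℕ} (hIN : I ⊆ N)
    {x y : ℕ → ℝ≥0∞} (h : ∀ k ∈ N, x k = y k) :
    x ∈ lastCrossing c I M t ↔ y ∈ lastCrossing c I M t := by
  have havg : ∀ u, average x (upTo I u) = average y (upTo I u) := fun u =>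
    average_congr fun i hi => h i (hIN (mem_upTo.1 hi).2)
  simp only [lastCrossing, Set.mem_ofPred_eq, havg]

theorem Exchangeable.setLIntegral_lastCrossing (h : Exchangeable (fun t : N => E t) P)
    (hE : ∀ t, Measurable (E t)) {I : Set ℕ} (hIN : I ⊆ N) (c : ℝ≥0∞) (M : ℕ) {t i j : ℕ}
    (hi : i ∈ upTo I t) (hj : j ∈ upTo I t) :
    ∫⁻ ω in {ω | (fun k => E k ω) ∈ lastCrossing c I M t}, E i ω ∂P =
      ∫⁻ ω in {ω | (fun k => E k ω) ∈ lastCrossing c I M t}, E j ω ∂P := by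
  have hL := measurableSet_lastCrossing c I M t
  have hB : MeasurableSet {ω | (fun k => E k ω) ∈ lastCrossing c I M t} :=
    measurable_pi_lambda _ hE hL
  have hjN := hIN (mem_upTo.1 hj).2
  have key := h.lintegral_swap hE (hIN (mem_upTo.1 hi).2) hjN
    (G := (lastCrossing c I M t).indicator fun x => x j)
    ((measurable_pi_apply j).indicator hL) (by
      intro x y hxy
      classical
      simp only [Set.indicator_apply, mem_lastCrossing_congr hIN hxy, hxy j hjN])
  rw [← lintegral_indicator hB, ← lintegral_indicator hB]
  refine Eq.trans (lintegral_congr fun ω => ?_) (key.trans (lintegral_congr fun ω => ?_))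
  · classical
    have := swap_mem_lastCrossing_iff (c := c) (M := M) hi hj (fun k => E k ω)
    simp only [Set.indicator_apply, this, Equiv.swap_apply_right, Set.mem_ofPred_eq]
  · rfl

theorem Exchangeable.mul_measure_lastCrossing_le (h : Exchangeable (fun t : N => E t) P)
    (hE : ∀ t, Measurable (E t)) {I : Set ℕ} (hIN : I ⊆ N) (c : ℝ≥0∞) (M : ℕ) {t j : ℕ}
    (hj : j ∈ upTo I t) :
    c * P {ω | (fun k => E k ω) ∈ lastCrossing c I M t} ≤
      ∫⁻ ω in {ω | (fun k => E k ω) ∈ lastCrossing c I M t}, E j ω ∂P := by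
  have hL := measurableSet_lastCrossing c I M t
  set B := {ω | (fun k => E k ω) ∈ lastCrossing c I M t} with hBdef
  have hB : MeasurableSet B := measurable_pi_lambda _ hE hL
  have hne : (upTo I t).Nonempty := ⟨j, hj⟩
  have h0 : ((upTo I t).card : ℝ≥0∞) ≠ 0 := by simpa using hne.ne_empty
  have hsum : ((upTo I t).card : ℝ≥0∞) * ∫⁻ ω in B, E j ω ∂P =
      ∫⁻ ω in B, ∑ i ∈ upTo I t, E i ω ∂P := by
    rw [lintegral_finsetSum _ fun i _ => hE i,
      Finset.sum_congr rfl fun i hi => h.setLIntegral_lastCrossing hE hIN c M hi hj,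
      Finset.sum_const, nsmul_eq_mul]
  rw [← ENNReal.mul_le_mul_iff_right h0 (ENNReal.natCast_ne_top _), hsum, ← mul_assoc,
    mul_comm _ c, ← setLIntegral_const]
  exact setLIntegral_mono' hB fun ω hω => (le_average_iff hne).1 hω.1

/-- **Ville's inequality for exchangeable sequences**: the maximal inequality for the running
averages, up to a finite time. -/
theorem Exchangeable.mul_measure_exists_le (h : Exchangeable (fun t : N => E t) P)
    (hE : ∀ t, Measurable (E t)) {I : Set ℕ} (hIN : I ⊆ N) (c : ℝ≥0∞) (M : ℕ) {j : ℕ}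
    (hj : j ∈ I) (hmin : ∀ i ∈ I, j ≤ i) :
    c * P {ω | ∃ t ∈ I, t ≤ M ∧ c ≤ average (fun i => E i ω) (upTo I t)} ≤
      ∫⁻ ω, E j ω ∂P := by
  let B : ℕ → Set Ω := fun t => {ω | (fun k => E k ω) ∈ lastCrossing c I M t}
  have hB : ∀ t, MeasurableSet (B t) := fun t =>
    measurable_pi_lambda _ hE (measurableSet_lastCrossing c I M t)
  have hsub : {ω | ∃ t ∈ I, t ≤ M ∧ c ≤ average (fun i => E i ω) (upTo I t)} ⊆
      ⋃ t ∈ upTo I M, B t := by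
    classical
    rintro ω ⟨t, htI, htM, ht⟩
    obtain ⟨u, hu, humax⟩ := Finset.exists_max_image
      ((upTo I M).filter fun t => c ≤ average (fun i => E i ω) (upTo I t)) id
      ⟨t, Finset.mem_filter.2 ⟨mem_upTo.2 ⟨htM, htI⟩, ht⟩⟩
    obtain ⟨hu1, hu2⟩ := Finset.mem_filter.1 hu
    refine Set.mem_iUnion₂.2 ⟨u, hu1, hu2, fun v hvI huv hvM => ?_⟩
    by_contra! hv
    exact not_le.2 huv (humax v (Finset.mem_filter.2 ⟨mem_upTo.2 ⟨hvM, hvI⟩, hv⟩))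
  have hdisj : (upTo I M : Set ℕ).PairwiseDisjoint B := by
    intro t ht u hu htu
    have aux : ∀ {t u ω}, u ∈ upTo I M → t < u → ω ∈ B t → ω ∉ B u := by
      intro t u ω hu htu hωt hωu
      exact not_le.2 (hωt.2 u (mem_upTo.1 hu).2 htu (mem_upTo.1 hu).1) hωu.1
    refine Set.disjoint_left.2 fun ω hωt hωu => ?_
    rcases lt_or_gt_of_ne htu with hlt | hlt
    · exact aux hu hlt hωt hωu
    · exact aux ht hlt hωu hωt
  calc c * P {ω | ∃ t ∈ I, t ≤ M ∧ c ≤ average (fun i => E i ω) (upTo I t)}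
      ≤ c * P (⋃ t ∈ upTo I M, B t) := by gcongr
    _ = ∑ t ∈ upTo I M, c * P (B t) := by
        rw [measure_biUnion_finset hdisj fun t _ => hB t, Finset.mul_sum]
    _ ≤ ∑ t ∈ upTo I M, ∫⁻ ω in B t, E j ω ∂P := by
        -- The least element `j` of `I` lies in every initial segment, so one e-value serves all
        -- `t`.
        refine Finset.sum_le_sum fun t ht => h.mul_measure_lastCrossing_le hE hIN c M ?_
        exact mem_upTo.2 ⟨hmin t (mem_upTo.1 ht).2, hj⟩
    _ = ∫⁻ ω in ⋃ t ∈ upTo I M, B t, E j ω ∂P :=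
        (lintegral_biUnion_finset hdisj (fun t _ => hB t) _).symm
    _ ≤ ∫⁻ ω, E j ω ∂P := setLIntegral_le_lintegral _ _

theorem Exchangeable.measure_exeTest_le {α : ℝ} (hα : 0 < α)
    (h : Exchangeable (fun t : N => E t) P) (hE : ∀ t, Measurable (E t))
    (hint : ∀ t ∈ N, ∫⁻ ω, E t ω ∂P ≤ 1) {I : Set ℕ} (hIN : I ⊆ N) :
    P {ω | exeTest α E I ω} ≤ ENNReal.ofReal α := by
  classical
  rcases I.eq_empty_or_nonempty with rfl | hne
  · simp [not_exeTest_empty]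
  have hset : {ω | exeTest α E I ω} = ⋃ M : ℕ, {ω | ∃ t ∈ I, t ≤ M ∧
      1 / ENNReal.ofReal α ≤ average (fun i => E i ω) (upTo I t)} := by
    ext ω
    simp only [exeTest, Set.mem_ofPred_eq, Set.mem_iUnion]
    exact ⟨fun ⟨t, h1, h2⟩ => ⟨t, t, h1, le_rfl, h2⟩, fun ⟨_, t, h1, _, h2⟩ => ⟨t, h1, h2⟩⟩
  rw [hset, Monotone.measure_iUnion]
  · refine iSup_le fun M => ?_
    have hle := (h.mul_measure_exists_le hE hIN (1 / ENNReal.ofReal α) M (Nat.find_spec hne)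
      fun i hi => Nat.find_min' hne hi).trans (hint _ (hIN (Nat.find_spec hne)))
    rw [one_div, ← ENNReal.div_eq_inv_mul] at hle
    have h0 : ENNReal.ofReal α ≠ 0 := by simpa using hα
    simpa using (ENNReal.div_le_iff h0 ENNReal.ofReal_ne_top).1 hle
  · rintro M M' hM ω ⟨t, h1, h2, h3⟩
    exact ⟨t, h1, h2.trans hM, h3⟩

end MaximalInequality

end OnlineDiscovery

theorem mainTheorem7 {Ω : Type*} {m : MeasurableSpace Ω} (ℱ : Filtration ℕ m)
    (𝓜 : Set (ProbabilityMeasure Ω)) (H : ℕ → Set (ProbabilityMeasure Ω))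
    (hH : ∀ t, H t ⊆ 𝓜) (α : ℝ) (hα0 : 0 < α) (hα1 : α ≤ 1)
    (E : ℕ → Ω → ℝ≥0∞) (hmeas : ∀ t, Measurable[ℱ t] (E t))
    (hE : ∀ t, ∀ P ∈ H t, ∫⁻ ω, E t ω ∂(P : Measure Ω) ≤ 1)
    (hexch : ∀ P ∈ 𝓜, OnlineDiscovery.Exchangeable
      (fun t : OnlineDiscovery.trueNulls H P => E t) (P : Measure Ω)) :
    (OnlineDiscovery.IsLevelTests 𝓜 H α (OnlineDiscovery.exeTest α E) ∧
      OnlineDiscovery.IsOnlineTests ℱ (OnlineDiscovery.exeTest α E) ∧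
      OnlineDiscovery.IsIncreasing (OnlineDiscovery.exeTest α E)) ∧
    (OnlineDiscovery.IsOnlineProcedure ℱ
        (OnlineDiscovery.closedProcedure (OnlineDiscovery.exeTest α E)) ∧
      OnlineDiscovery.HasTrueDiscoveryGuarantee 𝓜 H α
        (OnlineDiscovery.closedProcedure (OnlineDiscovery.exeTest α E))) ∧
    ∀ s : ℕ → Ω → OnlineDiscovery.GuardState,
      (∀ ω, OnlineDiscovery.IsGuardRun α (fun t => E t ω) (fun n => s n ω)) →
      (∀ n ω, (s n ω).d =
        OnlineDiscovery.closedProcedure (OnlineDiscovery.exeTest α E) (s n ω).S ω) ∧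
      ∀ P ∈ 𝓜, ENNReal.ofReal (1 - α) ≤ (P : Measure Ω)
        {ω | ∀ n, (s n ω).d ≤
          (((s n ω).S : Set ℕ) ∩ OnlineDiscovery.falseNulls H P).ncard} := by
  have hE' : ∀ t, Measurable (E t) := fun t => (hmeas t).mono (ℱ.le t) le_rfl
  have hlevel : OnlineDiscovery.IsLevelTests 𝓜 H α (OnlineDiscovery.exeTest α E) :=
    fun I P hP => (hexch P hP.1).measure_exeTest_le hα0 hE' (fun t ht => hE t P ht) hP.2
  have hon := OnlineDiscovery.isOnlineTests_exeTest α hmeas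
  have hinc := OnlineDiscovery.isIncreasing_exeTest α E
  have hguar := OnlineDiscovery.hasTrueDiscoveryGuarantee_closedProcedure hα0 hlevel hon
  refine ⟨⟨hlevel, hon, hinc⟩,
    ⟨hinc.isOnlineProcedure hon (OnlineDiscovery.not_exeTest_empty α E), hguar⟩, ?_⟩
  intro s hs
  have hd := fun n ω => (hs ω).d_eq_closedProcedure hα0 n
  -- The event for `s` need not be measurable, as `s` depends arbitrarily on `ω`; monotonicity of
  -- the outer measure suffices.
  refine ⟨hd, fun P hP => (hguar P hP).trans (measure_mono fun ω hω n => ?_)⟩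
  rw [hd n ω]
  exact hω _
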